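/- **Setting.** A probabilistic program is given by its control flow graph: a finite set $L$ of labels, a terminal label $\bot\notin L$, a finite set $X$ of real program variables and a finite set $R$ of real sampling variables. Write $L_\bot=L\cup\{\bot\}$. Each sampling variable $r$ has a probability distribution on $\mathbb R$ and a non-empty bounded interval $\mathrm{Supp}_r$ of probability one. Each $\ell\in L$ is of one of four kinds: *demonic* (a non-empty finite set of transitions to targets $\ell'\in L_\bot$); *probabilistic* (finitely many transitions with probabilities in $(0,1)$ summing to $1$); *branching* (finitely many transitions guarded by propositional polynomial predicates over $X$, i.e. Boolean combinations of polynomial inequalities, exactly one of which holds at each $\mathbf x\in\mathbb R^{X}$); *assignment* (a single transition to some $\ell'$ with a measurable update function $f:\mathbb R^X\times\mathbb R^R\to\mathbb R^X$). A configuration is a pair $(\ell,\mathbf x)\in L_\bot\times\mathbb R^X$. From a configuration $(\ell,\mathbf x)$ with $\ell\neq\bot$ the program moves to $(\ell',\mathbf x)$, where $\ell'$ is selected by the scheduler (demonic), drawn with the given probabilities (probabilistic), or is the target whose guard holds at $\mathbf x$ (branching), or it moves to $(\ell',f(\mathbf x,\mathbf r))$ with $\mathbf r$ a fresh sample of independent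 sampling variables (assignment); configurations $(\bot,\mathbf x)$ are absorbing. A (measurable) scheduler $\sigma$ selects a transition after each finite sequence of configurations that ends in a demonic label. With an initial configuration $(\ell_0,\mathbf x_0)$ it induces a probability measure $\mathbb P^\sigma$ on runs $((\ell_n,\mathbf x_n))_{n\ge0}$. Let $T_P=\min\{n\ge 0:\ell_n=\bot\}\in\mathbb N_0\cup\{\infty\}$ be the termination time. Let $I$ be a polynomial invariant: it assigns to each $\ell\in L_\bot$ a propositional polynomial predicate $I(\ell)$ such that $\mathbf x\models I(\ell)$ for every configuration $(\ell,\mathbf x)$ that is reachable from $(\ell_0,\mathbf x_0)$ along a finite path, with sampled values in the sets $\mathrm{Supp}_r$. For $\eta:L_\bot\times\mathbb R^X\to\mathbb R$, the pre-expectation $\mathrm{pre}_\eta(\ell,\mathbf x)$ is: $\max_{\ell'}\eta(\ell',\mathbf x)$ over the targets $\ell'$ if $\ell$ is demonic; $\sum z\,\eta(\ell',\mathbf x)$ over the transitions with probability $z$ and target $\ell'$ if $\ell$ is probabilistic; $\eta(\ell',\mathbf x)$ for the target $\ell'$ whose guard holds at $\mathbf x$ if $\ell$ is branching; $\mathbb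 E\,\eta(\ell',f(\mathbf x,\mathbf r))$ over the independent sampling variables $\mathbf r$ if $\ell$ is an assignment label. Let $\mathrm{TERM}(\ell)$ be the disjunction of the guards of the transitions of $\ell$ with target different from $\bot$ if $\ell$ is branching, and *true* otherwise. The map $\eta$ is a $d$-pRSM (polynomial ranking supermartingale map of degree $d$) with constants $\epsilon>0$ and $K\le-\epsilon$ if: each $\eta(\ell,\cdot)$, $\ell\in L_\bot$, is a polynomial of degree at most $d$; $\eta(\ell,\mathbf x)\ge0$ whenever $\ell\ne\bot$ and $\mathbf x\models I(\ell)$; $\eta(\bot,\mathbf x)=K$ for all $\mathbf x$; and $\mathrm{pre}_\eta(\ell,\mathbf x)\le\eta(\ell,\mathbf x)-\epsilon$ whenever $\ell\neq\bot$ and $\mathbf x\models I(\ell)\wedge\mathrm{TERM}(\ell)$. It is difference-bounded with respect to a non-empty interval $[a,b]\subseteq\mathbb R$ if, for every $\ell\in L$, every $\mathbf x\models I(\ell)$ and every transition from $\ell$ to a target $\ell'$, one has $a\le\eta(\ell',\mathbf x')-\eta(\ell,\mathbf x)\le b$, where: if $\ell$ is demonic or probabilistic, $\mathbf x'=\mathbf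 x$; if $\ell$ is branching, $\mathbf x'=\mathbf x$ and the condition is imposed only when the guard of the transition holds at $\mathbf x$; if $\ell$ is an assignment label, $\mathbf x'=f(\mathbf x,\mathbf r)$ and the condition is imposed for all $\mathbf r\in\prod_{r\in R}\mathrm{Supp}_r$. **Theorem.** Let $\eta$ be a $d$-pRSM with constants $\epsilon,K$ that is difference-bounded with respect to $[a,b]$. Then for every scheduler $\sigma$ and every integer $n\ge1$ with $\epsilon(n-1)>\eta(\ell_0,\mathbf x_0)$, $$\mathbb P^\sigma(T_P>n)\le\exp\left(-\frac{2\left(\epsilon(n-1)-\eta(\ell_0,\mathbf x_0)\right)^2}{(n-1)(b-a)^2}\right),$$ where the right-hand side is read as $0$ if $(n-1)(b-a)^2=0$. Consequently, every non-negative integer $M\ge\eta(\ell_0,\mathbf x_0)/\epsilon+2$ is a concentration bound for the termination time: there are constants $c_1\ge0$ and $c_2>0$ such that $\mathbb P^\sigma(T_P>N)\le c_1e^{-c_2N}$ for all integers $N\ge M$ and all schedulers $\sigma$. -/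

import Mathlib

namespace ProbProg

open MeasureTheory ProbabilityTheory

noncomputable section

/-- Comparison symbols `<`, `≤`, `>`, `≥`. -/
inductive Cmp
  | lt | le | gt | ge

/-- The relation on `ℝ` denoted by a comparison symbol. -/
def Cmp.Holds : Cmp → ℝ → ℝ → Prop
  | .lt, s, t => s < t
  | .le, s, t => s ≤ t
  | .gt, s, t => s > t
  | .ge, s, t => s ≥ t

/-- Propositional polynomial predicates over the variables `X`. -/
inductive PolyPred (X : Type*)
  | tru
  | fls
  | atom (g₁ : MvPolynomial X ℝ) (c : Cmp) (g₂ : MvPolynomial X ℝ)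
  | neg (φ : PolyPred X)
  | conj (φ ψ : PolyPred X)
  | disj (φ ψ : PolyPred X)

/-- The satisfaction relation `x ⊨ φ`. -/
def PolyPred.Sat {X : Type*} (x : X → ℝ) : PolyPred X → Prop
  | .tru => True
  | .fls => False
  | .atom g₁ c g₂ => c.Holds (MvPolynomial.eval x g₁) (MvPolynomial.eval x g₂)
  | .neg φ => ¬ φ.Sat x
  | .conj φ ψ => φ.Sat x ∧ ψ.Sat x
  | .disj φ ψ => φ.Sat x ∨ ψ.Sat x

/-- `L` together with the terminal label `⊥`; it carries the discrete σ-algebra. -/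
inductive Loc (L : Type*)
  | term
  | lab (ℓ : L)

instance {L : Type*} : MeasurableSpace (Loc L) := ⊤

instance {L : Type*} : DiscreteMeasurableSpace (Loc L) := ⟨fun _ => trivial⟩

/-- Configurations `(ℓ, x)`: a label (possibly terminal) and a valuation of the program variables. -/
abbrev Config (L X : Type*) := Loc L × (X → ℝ)

/-- The outgoing transitions of one label, according to the kind of the label:
* demonic: a nonempty finite set of targets;
* probabilistic: finitely many targets with probabilities in `(0, 1)` that add up to `1`;
* branching: finitely many guarded targets, exactly one guard being true at each valuation;
* assignment: one target together with a (Borel measurable) update function. -/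
inductive Block (L X R : Type*)
  | demonic (T : Finset (Loc L)) (hT : T.Nonempty)
  | prob (k : ℕ) (p : Fin k → ℝ) (tgt : Fin k → Loc L)
      (hp : ∀ i, p i ∈ Set.Ioo (0 : ℝ) 1) (hsum : ∑ i, p i = 1)
  | branch (k : ℕ) (φ : Fin k → PolyPred X) (tgt : Fin k → Loc L)
      (hφ : ∀ x : X → ℝ, ∃! i, (φ i).Sat x)
  | assign (f : (X → ℝ) → (R → ℝ) → (X → ℝ)) (hf : Measurable (Function.uncurry f))
      (tgt : Loc L)

/-- A control flow graph with nonterminal labels `L`, program variables `X` and sampling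
variables `R`, given by the outgoing transitions of each nonterminal label. -/
structure CFG (L X R : Type*) where
  block : L → Block L X R

/-- A bounded sampling variable: its distribution, and a nonempty bounded interval in which
its values lie with probability one. -/
structure SamplingVar where
  law : Measure ℝ
  isProb : IsProbabilityMeasure law
  supp : Set ℝ
  supp_nonempty : supp.Nonempty
  supp_interval : supp.OrdConnected
  supp_bounded : Bornology.IsBounded supp
  ae_mem_supp : ∀ᵐ t ∂law, t ∈ supp

instance (s : SamplingVar) : IsProbabilityMeasure s.law := s.isProb

variable {L X R : Type*}

/-- The joint distribution of the (independent) sampling variables. -/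
def sampleLaw [Fintype R] (D : R → SamplingVar) : Measure (R → ℝ) :=
  Measure.pi fun i => (D i).law

instance [Fintype R] (D : R → SamplingVar) : IsProbabilityMeasure (sampleLaw D) := by
  unfold sampleLaw; infer_instance

/-- The index of the only true guard of a branching label. -/
def trueGuard {k : ℕ} {φ : Fin k → PolyPred X} (hφ : ∀ x : X → ℝ, ∃! i, (φ i).Sat x)
    (x : X → ℝ) : Fin k :=
  (hφ x).exists.choose

/-! ### Paths, reachability and invariants -/

/-- `Step G D c c'`: the path `c, c'` is admissible, i.e. `c'` may follow `c` in a finite path. -/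
inductive Step (G : CFG L X R) (D : R → SamplingVar) : Config L X → Config L X → Prop
  | term (x : X → ℝ) : Step G D (.term, x) (.term, x)
  | demonic {ℓ : L} {T : Finset (Loc L)} {hT : T.Nonempty} (h : G.block ℓ = .demonic T hT)
      {ℓ' : Loc L} (hℓ' : ℓ' ∈ T) (x : X → ℝ) : Step G D (.lab ℓ, x) (ℓ', x)
  | prob {ℓ : L} {k : ℕ} {p : Fin k → ℝ} {tgt : Fin k → Loc L} {hp} {hsum}
      (h : G.block ℓ = .prob k p tgt hp hsum) (i : Fin k) (x : X → ℝ) :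
      Step G D (.lab ℓ, x) (tgt i, x)
  | branch {ℓ : L} {k : ℕ} {φ : Fin k → PolyPred X} {tgt : Fin k → Loc L} {hφ}
      (h : G.block ℓ = .branch k φ tgt hφ) (i : Fin k) (x : X → ℝ) (hx : (φ i).Sat x) :
      Step G D (.lab ℓ, x) (tgt i, x)
  | assign {ℓ : L} {f : (X → ℝ) → (R → ℝ) → (X → ℝ)} {hf} {tgt : Loc L}
      (h : G.block ℓ = .assign f hf tgt) (x : X → ℝ) (r : R → ℝ)
      (hr : ∀ i, r i ∈ (D i).supp) : Step G D (.lab ℓ, x) (tgt, f x r)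

/-- `c` is reachable from `c₀` along a finite path. -/
def Reachable (G : CFG L X R) (D : R → SamplingVar) (c₀ c : Config L X) : Prop :=
  Relation.ReflTransGen (Step G D) c₀ c

/-- `I` is a polynomial invariant for the initial configuration `c₀`. -/
def IsInvariant (G : CFG L X R) (D : R → SamplingVar) (c₀ : Config L X)
    (I : Loc L → PolyPred X) : Prop :=
  ∀ ℓ x, Reachable G D c₀ (ℓ, x) → (I ℓ).Sat x

/-! ### Schedulers and the probability measure on runs -/

/-- Finite sequences of configurations with time indices `0, …, n`. -/
abbrev History (L X : Type*) (n : ℕ) := (i : Finset.Iic n) → (fun _ : ℕ => Config L X) i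

/-- The configuration at the end of a history. -/
def History.last {n : ℕ} (h : History L X n) : Config L X :=
  h ⟨n, Finset.mem_Iic.2 le_rfl⟩

/-- A (measurable) scheduler: after every history that ends in a demonic label it selects one of
the transitions of this label, represented by its target. Its values after other histories are
irrelevant. -/
structure Scheduler (G : CFG L X R) where
  choice : (n : ℕ) → History L X n → Loc L
  measurable_choice : ∀ n, Measurable (choice n)
  choice_mem : ∀ (n : ℕ) (h : History L X n) (ℓ : L) (T : Finset (Loc L)) (hT : T.Nonempty),
    h.last.1 = .lab ℓ → G.block ℓ = .demonic T hT → choice n h ∈ T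

/-- The distribution of the next configuration when the block of the current label is given, the
current valuation is `x`, and `m` is the target selected by the scheduler. -/
def Block.next [Fintype R] (D : R → SamplingVar) (m : Loc L) (x : X → ℝ) :
    Block L X R → Measure (Config L X)
  | .demonic _ _ => Measure.dirac (m, x)
  | .prob _ p tgt _ _ => ∑ i, ENNReal.ofReal (p i) • Measure.dirac (tgt i, x)
  | .branch _ _ tgt hφ => Measure.dirac (tgt (trueGuard hφ x), x)
  | .assign f _ tgt => (sampleLaw D).map fun r => (tgt, f x r)

/-- The distribution of the next configuration when the current one is `(ℓ, x)` and `m` is the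
target selected by the scheduler. -/
def stepLaw [Fintype R] (G : CFG L X R) (D : R → SamplingVar) (m : Loc L) :
    Loc L → (X → ℝ) → Measure (Config L X)
  | .term, x => Measure.dirac (.term, x)
  | .lab ℓ, x => (G.block ℓ).next D m x

instance [Finite L] : Countable (Loc L) := by
  have e : Loc L ≃ Option L :=
    { toFun := fun | .term => none | .lab ℓ => some ℓ
      invFun := fun | none => .term | some ℓ => .lab ℓ
      left_inv := fun a => by cases a <;> rfl
      right_inv := fun a => by cases a <;> rfl }
  exact e.countable_iff.2 inferInstance

theorem measurableSet_sat [Finite X] (φ : PolyPred X) : MeasurableSet {x | φ.Sat x} := by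
  have hc : ∀ g : MvPolynomial X ℝ, Measurable fun x : X → ℝ => MvPolynomial.eval x g :=
    fun g => (MvPolynomial.continuous_eval g).measurable
  induction φ with
  | tru => exact MeasurableSet.univ
  | fls => exact MeasurableSet.empty
  | atom g₁ c g₂ =>
    cases c
    · exact measurableSet_lt (hc g₁) (hc g₂)
    · exact measurableSet_le (hc g₁) (hc g₂)
    · exact measurableSet_lt (hc g₂) (hc g₁)
    · exact measurableSet_le (hc g₂) (hc g₁)
  | neg φ ih => exact ih.compl
  | conj φ ψ ih₁ ih₂ => exact ih₁.inter ih₂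
  | disj φ ψ ih₁ ih₂ => exact ih₁.union ih₂

theorem trueGuard_eq_iff {k : ℕ} {φ : Fin k → PolyPred X}
    (hφ : ∀ x : X → ℝ, ∃! i, (φ i).Sat x) (x : X → ℝ) (i : Fin k) :
    trueGuard hφ x = i ↔ (φ i).Sat x := by
  have h : (φ (trueGuard hφ x)).Sat x := (hφ x).exists.choose_spec
  exact ⟨fun e => e ▸ h, fun hi => (hφ x).unique h hi⟩

theorem measurable_trueGuard [Finite X] {k : ℕ} {φ : Fin k → PolyPred X}
    (hφ : ∀ x : X → ℝ, ∃! i, (φ i).Sat x) : Measurable (trueGuard hφ) := by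
  refine measurable_to_countable' fun i => ?_
  have : trueGuard hφ ⁻¹' {i} = {x | (φ i).Sat x} := by
    ext x; simp [trueGuard_eq_iff]
  rw [this]
  exact measurableSet_sat _

theorem measurable_blockNext [Finite X] [Fintype R] (D : R → SamplingVar) (m : Loc L)
    (B : Block L X R) : Measurable fun x => B.next D m x := by
  cases B with
  | demonic T hT => exact Measure.measurable_dirac.comp (by fun_prop)
  | prob k p tgt hp hsum =>
    refine Measure.measurable_of_measurable_coe _ fun s hs => ?_
    simp only [Block.next, Measure.coe_finsetSum, Measure.coe_smul, Finset.sum_apply,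
      Pi.smul_apply, smul_eq_mul]
    refine Finset.measurable_sum _ fun i _ => Measurable.const_mul ?_ _
    exact (Measure.measurable_coe hs).comp (Measure.measurable_dirac.comp (by fun_prop))
  | branch k φ tgt hφ =>
    refine Measure.measurable_dirac.comp (Measurable.prodMk ?_ measurable_id)
    exact (measurable_of_countable tgt).comp (measurable_trueGuard hφ)
  | assign f hf tgt =>
    refine Measure.measurable_of_measurable_coe _ fun s hs => ?_
    have hF : Measurable fun q : (X → ℝ) × (R → ℝ) => ((tgt, f q.1 q.2) : Config L X) :=
      measurable_const.prodMk hf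
    have : ∀ x, (Block.assign f hf tgt : Block L X R).next D m x s =
        sampleLaw D (Prod.mk x ⁻¹' ((fun q : (X → ℝ) × (R → ℝ) =>
          ((tgt, f q.1 q.2) : Config L X)) ⁻¹' s)) := fun x =>
      Measure.map_apply (hF.comp measurable_prodMk_left) hs
    simp only [this]
    exact measurable_measure_prodMk_left (hF hs)

theorem isProbabilityMeasure_blockNext [Fintype R] (D : R → SamplingVar) (m : Loc L) (x : X → ℝ)
    (B : Block L X R) : IsProbabilityMeasure (B.next D m x) := by
  cases B with
  | demonic T hT => exact Measure.dirac.isProbabilityMeasure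
  | prob k p tgt hp hsum =>
    refine ⟨?_⟩
    simp only [Block.next, Measure.coe_finsetSum, Measure.coe_smul, Finset.sum_apply,
      Pi.smul_apply, smul_eq_mul, measure_univ, mul_one]
    rw [← ENNReal.ofReal_sum_of_nonneg fun i _ => (hp i).1.le, hsum, ENNReal.ofReal_one]
  | branch k φ tgt hφ => exact Measure.dirac.isProbabilityMeasure
  | assign f hf tgt =>
    exact Measure.isProbabilityMeasure_map
      (measurable_const.prodMk (hf.comp measurable_prodMk_left)).aemeasurable

theorem measurable_stepLaw [Finite L] [Finite X] [Fintype R] (G : CFG L X R)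
    (D : R → SamplingVar) :
    Measurable fun q : Loc L × Loc L × (X → ℝ) => stepLaw G D q.1 q.2.1 q.2.2 := by
  refine measurable_from_prod_countable_right fun m => ?_
  refine measurable_from_prod_countable_right fun ℓ => ?_
  cases ℓ with
  | term => exact Measure.measurable_dirac.comp (by fun_prop)
  | lab ℓ => exact measurable_blockNext D m _

theorem measurable_last {n : ℕ} : Measurable (History.last : History L X n → Config L X) :=
  measurable_pi_apply _

/-- The transition kernel of the program under the scheduler `σ` at time `n`. -/
def stepKernel [Finite L] [Finite X] [Fintype R] (G : CFG L X R) (D : R → SamplingVar)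
    (σ : Scheduler G) (n : ℕ) : Kernel (History L X n) (Config L X) where
  toFun h := stepLaw G D (σ.choice n h) h.last.1 h.last.2
  measurable' :=
    (measurable_stepLaw G D).comp ((σ.measurable_choice n).prodMk measurable_last)

instance [Finite L] [Finite X] [Fintype R] (G : CFG L X R) (D : R → SamplingVar)
    (σ : Scheduler G) (n : ℕ) : IsMarkovKernel (stepKernel G D σ n) := by
  refine ⟨fun h => ?_⟩
  change IsProbabilityMeasure (stepLaw G D (σ.choice n h) h.last.1 h.last.2)
  cases h.last.1 with
  | term => exact Measure.dirac.isProbabilityMeasure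
  | lab ℓ => exact isProbabilityMeasure_blockNext D _ _ _

/-- The probability measure on runs induced by the scheduler `σ` and the initial
configuration `c₀` (Ionescu-Tulcea). -/
def runMeasure [Finite L] [Finite X] [Fintype R] (G : CFG L X R) (D : R → SamplingVar)
    (c₀ : Config L X) (σ : Scheduler G) : Measure (ℕ → Config L X) :=
  Kernel.trajMeasure (X := fun _ => Config L X) (Measure.dirac c₀) (stepKernel G D σ)

/-- The termination time of a run; it is `⊤` if the run does not terminate. -/
def termTime (ω : ℕ → Config L X) : ℕ∞ :=
  ⨅ (n : ℕ) (_ : (ω n).1 = .term), (n : ℕ∞)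

/-- The probability under `σ` that the termination time exceeds `n`. -/
def probTermGT [Finite L] [Finite X] [Fintype R] (G : CFG L X R) (D : R → SamplingVar)
    (c₀ : Config L X) (σ : Scheduler G) (n : ℕ) : ℝ :=
  (runMeasure G D c₀ σ).real {ω | (n : ℕ∞) < termTime ω}

/-- `M` is a concentration bound: the probability that the termination time exceeds `N` decreases
exponentially for `N ≥ M`, uniformly in the scheduler. -/
def IsConcentrationBound [Finite L] [Finite X] [Fintype R] (G : CFG L X R)
    (D : R → SamplingVar) (c₀ : Config L X) (M : ℕ) : Prop :=
  ∃ c₁ c₂ : ℝ, 0 ≤ c₁ ∧ 0 < c₂ ∧ ∀ (σ : Scheduler G) (N : ℕ), M ≤ N →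
    probTermGT G D c₀ σ N ≤ c₁ * Real.exp (-c₂ * N)

/-! ### Polynomial ranking supermartingales -/

/-- The pre-expectation of `η`. -/
def preExp [Fintype R] (G : CFG L X R) (D : R → SamplingVar) (η : Loc L → (X → ℝ) → ℝ) :
    Loc L → (X → ℝ) → ℝ
  | .term, x => η .term x
  | .lab ℓ, x =>
    match G.block ℓ with
    | .demonic T hT => T.sup' hT fun ℓ' => η ℓ' x
    | .prob _ p tgt _ _ => ∑ i, p i * η (tgt i) x
    | .branch _ _ tgt hφ => η (tgt (trueGuard hφ x)) x
    | .assign f _ tgt => ∫ r, η tgt (f x r) ∂(sampleLaw D)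

/-- The predicate `TERM(ℓ)`: at a branching label, the disjunction of the guards of the
transitions with nonterminal target; `true` at all other labels. -/
def TermPred (G : CFG L X R) (ℓ : L) (x : X → ℝ) : Prop :=
  match G.block ℓ with
  | .branch _ φ tgt _ => ∃ i, tgt i ≠ .term ∧ (φ i).Sat x
  | _ => True

/-- `η` is a polynomial ranking supermartingale map of degree `d` with constants `ε` and `K`,
with respect to the program and the invariant `I`. -/
structure IsPRSM [Fintype R] (G : CFG L X R) (D : R → SamplingVar) (I : Loc L → PolyPred X)
    (d : ℕ) (η : Loc L → (X → ℝ) → ℝ) (ε K : ℝ) : Prop where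
  eps_pos : 0 < ε
  K_le : K ≤ -ε
  polynomial : ∀ ℓ, ∃ p : MvPolynomial X ℝ, p.totalDegree ≤ d ∧
    ∀ x, η ℓ x = MvPolynomial.eval x p
  nonneg : ∀ (ℓ : L) (x : X → ℝ), (I (.lab ℓ)).Sat x → 0 ≤ η (.lab ℓ) x
  terminal : ∀ x, η .term x = K
  decrease : ∀ (ℓ : L) (x : X → ℝ), (I (.lab ℓ)).Sat x → TermPred G ℓ x →
    preExp G D η (.lab ℓ) x ≤ η (.lab ℓ) x - ε

/-- `η` is difference-bounded with respect to the nonempty interval `[a, b]`. -/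
structure IsDifferenceBounded (G : CFG L X R) (D : R → SamplingVar) (I : Loc L → PolyPred X)
    (η : Loc L → (X → ℝ) → ℝ) (a b : ℝ) : Prop where
  le : a ≤ b
  demonic : ∀ (ℓ : L) T hT, G.block ℓ = .demonic T hT → ∀ ℓ' ∈ T, ∀ x,
    (I (.lab ℓ)).Sat x → η ℓ' x - η (.lab ℓ) x ∈ Set.Icc a b
  prob : ∀ (ℓ : L) k p tgt hp hsum, G.block ℓ = .prob k p tgt hp hsum → ∀ i x,
    (I (.lab ℓ)).Sat x → η (tgt i) x - η (.lab ℓ) x ∈ Set.Icc a b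
  branch : ∀ (ℓ : L) k φ tgt hφ, G.block ℓ = .branch k φ tgt hφ → ∀ i x,
    (I (.lab ℓ)).Sat x → (φ i).Sat x → η (tgt i) x - η (.lab ℓ) x ∈ Set.Icc a b
  assign : ∀ (ℓ : L) f hf tgt, G.block ℓ = .assign f hf tgt → ∀ x,
    (I (.lab ℓ)).Sat x → ∀ r : R → ℝ, (∀ i, r i ∈ (D i).supp) →
      η tgt (f x r) - η (.lab ℓ) x ∈ Set.Icc a b

end

end ProbProg

/-! The proof is a Chernoff argument with a killed exponential supermartingale. For `t ≥ 0` let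
`expRank η t` be `exp (t * η)` before termination and `0` afterwards. Where the invariant and TERM
hold, one step changes `η` by a quantity in `[a, b]` with mean at most `-ε`, so Hoeffding's lemma
(`lintegral_exp_le_of_mem_Icc`) shows that the expectation of `expRank` shrinks by the factor `exp
(-tε + t²(b-a)²/8)`. Where TERM fails, the next configuration is terminal and the expectation drops
to `0`. This is `lintegral_expRank_stepLaw_le`.

The invariant holds almost surely at each time (`IsInvariant.ae_runMeasure`), so the one-step
estimate iterates along runs (`lintegral_expRank_runMeasure_le`). A run alive at time `n` has `η ≥
0`, hence `expRank ≥ 1`, and Markov's inequality gives `probTermGT_le_exp`. Both claims follow by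
choosing `t`. -/

namespace ProbProg

open MeasureTheory ProbabilityTheory Preorder

noncomputable section

variable {L X R : Type*}

/-! ### The one-step law -/

/-- The target `m` may be selected by a scheduler at the label `ℓ`. -/
def Admissible (G : CFG L X R) (m ℓ : Loc L) : Prop :=
  ∀ (ℓ' : L) (T : Finset (Loc L)) (hT : T.Nonempty),
    ℓ = .lab ℓ' → G.block ℓ' = .demonic T hT → m ∈ T

theorem isProbabilityMeasure_stepLaw [Fintype R] (G : CFG L X R) (D : R → SamplingVar)
    (m ℓ : Loc L) (x : X → ℝ) : IsProbabilityMeasure (stepLaw G D m ℓ x) := by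
  cases ℓ with
  | term => exact Measure.dirac.isProbabilityMeasure
  | lab ℓ => exact isProbabilityMeasure_blockNext D _ _ _

theorem stepLaw_lab_of_block_eq [Fintype R] {G : CFG L X R} {ℓ : L} {B : Block L X R}
    (h : G.block ℓ = B) (D : R → SamplingVar) (m : Loc L) (x : X → ℝ) :
    stepLaw G D m (.lab ℓ) x = B.next D m x := by
  rw [stepLaw, h]

theorem ae_mem_supp_sampleLaw [Fintype R] (D : R → SamplingVar) :
    ∀ᵐ r ∂(sampleLaw D), ∀ i, r i ∈ (D i).supp := by
  rw [ae_all_iff]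
  intro i
  exact (Measure.tendsto_eval_ae_ae (μ := fun i => (D i).law)).eventually (D i).ae_mem_supp

/-- Links the combinatorial relation `Step` to the law of a step. Assignments are the only case with
a null set to discard: samples outside the supports. -/
theorem ae_stepLaw_of_forall_step [Fintype R] {G : CFG L X R} {D : R → SamplingVar}
    {m ℓ : Loc L} {x : X → ℝ} (hm : Admissible G m ℓ) {S : Set (Config L X)}
    (hS : MeasurableSet S) (h : ∀ c, Step G D (ℓ, x) c → c ∈ S) :
    ∀ᵐ c ∂(stepLaw G D m ℓ x), c ∈ S := by
  cases ℓ with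
  | term => exact (ae_dirac_iff hS).2 (h _ (.term x))
  | lab ℓ =>
    cases hB : G.block ℓ <;> rw [stepLaw_lab_of_block_eq hB]
    case demonic T hT => exact (ae_dirac_iff hS).2 (h _ (.demonic hB (hm ℓ T hT rfl hB) x))
    case prob k p tgt hp hsum =>
      rw [ae_iff]
      simp only [Block.next, Measure.coe_finsetSum, Measure.coe_smul, Finset.sum_apply,
        Pi.smul_apply, smul_eq_mul]
      refine Finset.sum_eq_zero fun i _ => ?_
      have : Measure.dirac (tgt i, x) {c | c ∉ S} = 0 :=
        (ae_dirac_iff hS).2 (h _ (.prob hB i x))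
      rw [this, mul_zero]
    case branch k φ tgt hφ =>
      exact (ae_dirac_iff hS).2 (h _ (.branch hB _ x ((trueGuard_eq_iff hφ x _).1 rfl)))
    case assign f hf tgt =>
      refine (ae_map_iff (measurable_const.prodMk
        (hf.comp measurable_prodMk_left)).aemeasurable hS).2 ?_
      filter_upwards [ae_mem_supp_sampleLaw D] with r hr
      exact h _ (.assign hB x r hr)

/-- The uncurried ranking function is Borel measurable. -/
theorem IsPRSM.measurable [Finite L] [Finite X] [Fintype R] {G : CFG L X R}
    {D : R → SamplingVar} {I : Loc L → PolyPred X} {d : ℕ} {η : Loc L → (X → ℝ) → ℝ} {ε K : ℝ}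
    (hη : IsPRSM G D I d η ε K) : Measurable fun c : Config L X => η c.1 c.2 := by
  refine measurable_from_prod_countable_right fun ℓ => ?_
  obtain ⟨p, -, hp⟩ := hη.polynomial ℓ
  simp only [hp]
  exact (MvPolynomial.continuous_eval p).measurable

theorem IsDifferenceBounded.of_step {G : CFG L X R} {D : R → SamplingVar}
    {I : Loc L → PolyPred X} {η : Loc L → (X → ℝ) → ℝ} {a b : ℝ}
    (hab : IsDifferenceBounded G D I η a b) {ℓ : L} {x : X → ℝ} (hx : (I (.lab ℓ)).Sat x)
    {c : Config L X} (hc : Step G D (.lab ℓ, x) c) :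
    η c.1 c.2 - η (.lab ℓ) x ∈ Set.Icc a b := by
  cases hc with
  | demonic h hℓ' => exact hab.demonic _ _ _ h _ hℓ' _ hx
  | prob h i => exact hab.prob _ _ _ _ _ _ h i _ hx
  | branch h i _ hi => exact hab.branch _ _ _ _ _ h i _ hx hi
  | assign h _ r hr => exact hab.assign _ _ _ _ h _ hx r hr

/-- Inequality is needed only at demonic labels, where the chosen target is bounded by the maximum;
all other kinds give equality. No integrability of `η` is required, since the change of variables
for assignments holds for Bochner integrals unconditionally. -/
theorem integral_stepLaw_le_preExp [Fintype R] {G : CFG L X R} {D : R → SamplingVar}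
    {η : Loc L → (X → ℝ) → ℝ} (hη : Measurable fun c : Config L X => η c.1 c.2)
    {m ℓ : Loc L} (hm : Admissible G m ℓ) (x : X → ℝ) :
    ∫ c, η c.1 c.2 ∂(stepLaw G D m ℓ x) ≤ preExp G D η ℓ x := by
  have hd : ∀ c : Config L X, ∫ c', η c'.1 c'.2 ∂(Measure.dirac c) = η c.1 c.2 := fun c =>
    integral_dirac' _ c hη.stronglyMeasurable
  cases ℓ with
  | term => exact (hd _).le
  | lab ℓ =>
    cases hB : G.block ℓ <;> rw [stepLaw_lab_of_block_eq hB] <;> simp only [preExp, hB, Block.next]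
    case demonic T hT =>
      rw [hd]
      exact Finset.le_sup' (fun ℓ' => η ℓ' x) (hm ℓ T hT rfl hB)
    case prob k p tgt hp hsum =>
      rw [integral_finsetSum_measure]
      · refine (Finset.sum_congr rfl fun i _ => ?_).le
        rw [integral_smul_measure, hd, ENNReal.toReal_ofReal (hp i).1.le, smul_eq_mul]
      · intro i _
        refine Integrable.smul_measure ?_ ENNReal.ofReal_ne_top
        exact integrable_dirac' hη.stronglyMeasurable (by simp)
    case branch k φ tgt hφ => exact (hd _).le
    case assign f hf tgt =>
      exact (integral_map (measurable_const.prodMk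
        (hf.comp measurable_prodMk_left)).aemeasurable hη.aestronglyMeasurable).le

/-- TERM can fail only at a branching label, and then the unique true guard must lead to `⊥`. -/
theorem ae_stepLaw_term_of_not_termPred [Fintype R] {G : CFG L X R} {D : R → SamplingVar}
    {m : Loc L} {ℓ : L} {x : X → ℝ} (h : ¬ TermPred G ℓ x) :
    ∀ᵐ c ∂(stepLaw G D m (.lab ℓ) x), c.1 = .term := by
  unfold TermPred at h
  cases hB : G.block ℓ with
  | branch k φ tgt hφ =>
    rw [stepLaw_lab_of_block_eq hB]
    simp only [hB, not_exists, not_and] at h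
    refine (ae_dirac_iff (p := fun c : Config L X => c.1 = .term) ?_).2 ?_
    · exact measurable_fst (MeasurableSet.of_discrete (s := {Loc.term}))
    · by_contra hne
      exact h _ hne ((trueGuard_eq_iff hφ x _).1 rfl)
  | _ => simp [hB] at h

/-! ### The exponential supermartingale -/

/-- Hoeffding's lemma for a bounded random variable whose mean is at most `-ε`. -/
theorem lintegral_exp_le_of_mem_Icc {Ω : Type*} [MeasurableSpace Ω] {μ : Measure Ω}
    [IsProbabilityMeasure μ] {Y : Ω → ℝ} {a b ε t : ℝ} (hY : AEMeasurable Y μ)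
    (hb : ∀ᵐ ω ∂μ, Y ω ∈ Set.Icc a b) (hε : ∫ ω, Y ω ∂μ ≤ -ε) (ht : 0 ≤ t) :
    ∫⁻ ω, ENNReal.ofReal (Real.exp (t * Y ω)) ∂μ ≤
      ENNReal.ofReal (Real.exp (-(t * ε) + t ^ 2 * (b - a) ^ 2 / 8)) := by
  have hint : Integrable (fun ω => Real.exp (t * Y ω)) μ := integrable_exp_mul_of_mem_Icc hY hb
  rw [← ofReal_integral_eq_lintegral_ofReal hint (ae_of_all _ fun _ => (Real.exp_pos _).le)]
  refine ENNReal.ofReal_le_ofReal ?_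
  have h := (hasSubgaussianMGF_of_mem_Icc hY hb).mgf_le t
  -- Split off the mean: the centred variable is sub-Gaussian with parameter `(b-a)²/4`, and the
  -- factor from the mean is at most `exp (-tε)` because `t ≥ 0`.
  have e : ∫ ω, Real.exp (t * Y ω) ∂μ =
      Real.exp (t * ∫ ω, Y ω ∂μ) * mgf (fun ω => Y ω - ∫ ω, Y ω ∂μ) μ t := by
    rw [mgf, ← integral_const_mul]
    congr 1 with ω
    rw [← Real.exp_add]
    congr 1
    ring
  rw [e]
  calc _ ≤ Real.exp (t * ∫ ω, Y ω ∂μ) * Real.exp _ := by gcongr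
    _ ≤ _ := by
      rw [← Real.exp_add]
      refine Real.exp_le_exp.2 ?_
      have h1 := mul_le_mul_of_nonneg_left hε ht
      have h2 : ((((‖b - a‖₊ / 2) ^ 2 : NNReal)) : ℝ) = (b - a) ^ 2 / 4 := by
        push_cast
        rw [Real.norm_eq_abs, div_pow, sq_abs]
        norm_num
      rw [h2]
      linarith

open Classical in
/-- The exponential of `t * η` on nonterminal configurations, and `0` on terminal ones. -/
def expRank (η : Loc L → (X → ℝ) → ℝ) (t : ℝ) (c : Config L X) : ENNReal :=
  if c.1 = .term then 0 else ENNReal.ofReal (Real.exp (t * η c.1 c.2))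

theorem measurable_expRank {η : Loc L → (X → ℝ) → ℝ}
    (hη : Measurable fun c : Config L X => η c.1 c.2) (t : ℝ) : Measurable (expRank η t) := by
  unfold expRank
  refine Measurable.ite ?_ measurable_const (by fun_prop)
  exact measurable_fst (MeasurableSet.of_discrete (s := {Loc.term}))

/-- Killing at `⊥` handles a failing TERM, where no decrease of `η` is assumed: the left side is
then `0`. Where TERM holds, killing only lowers the expectation, so Hoeffding's lemma for the
unkilled exponential suffices. -/
theorem lintegral_expRank_stepLaw_le [Finite L] [Finite X] [Fintype R] {G : CFG L X R}
    {D : R → SamplingVar} {I : Loc L → PolyPred X} {d : ℕ} {η : Loc L → (X → ℝ) → ℝ}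
    {ε K a b t : ℝ} (hη : IsPRSM G D I d η ε K) (hab : IsDifferenceBounded G D I η a b)
    (ht : 0 ≤ t) {m ℓ : Loc L} (hm : Admissible G m ℓ) {x : X → ℝ} (hx : (I ℓ).Sat x) :
    ∫⁻ c, expRank η t c ∂(stepLaw G D m ℓ x) ≤
      ENNReal.ofReal (Real.exp (-(t * ε) + t ^ 2 * (b - a) ^ 2 / 8)) * expRank η t (ℓ, x) := by
  have := isProbabilityMeasure_stepLaw G D m ℓ x
  cases ℓ with
  | term =>
    change ∫⁻ c, _ ∂(Measure.dirac _) ≤ _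
    rw [lintegral_dirac' _ (measurable_expRank hη.measurable t)]
    simp [expRank]
  | lab ℓ =>
    by_cases hT : TermPred G ℓ x
    · have hb : ∀ᵐ c ∂(stepLaw G D m (.lab ℓ) x),
          η c.1 c.2 - η (.lab ℓ) x ∈ Set.Icc a b :=
        ae_stepLaw_of_forall_step hm
          (S := {c | η c.1 c.2 - η (.lab ℓ) x ∈ Set.Icc a b})
          ((hη.measurable.sub_const _) measurableSet_Icc) fun c hc => hab.of_step hx hc
      have hYm : Measurable fun c : Config L X => η c.1 c.2 - η (.lab ℓ) x :=
        hη.measurable.sub_const _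
      -- Integrability of `η` comes from the difference bound: it is a constant plus a bounded
      -- increment.
      have hint : Integrable (fun c : Config L X => η c.1 c.2) (stepLaw G D m (.lab ℓ) x) := by
        refine ((Integrable.of_mem_Icc a b hYm.aemeasurable hb).add
          (integrable_const (η (.lab ℓ) x))).congr (ae_of_all _ fun c => ?_)
        simp
      have hmean : ∫ c, (η c.1 c.2 - η (.lab ℓ) x) ∂(stepLaw G D m (.lab ℓ) x) ≤ -ε := by
        rw [integral_sub hint (integrable_const _)]
        have h1 := integral_stepLaw_le_preExp (D := D) hη.measurable hm x
        have h2 := hη.decrease ℓ x hx hT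
        simp only [integral_const, probReal_univ, one_smul]
        linarith
      have hH := lintegral_exp_le_of_mem_Icc hYm.aemeasurable hb hmean ht
      have hle : ∀ c, expRank η t c ≤ ENNReal.ofReal (Real.exp (t * (η c.1 c.2 - η (.lab ℓ) x))) *
          expRank η t (.lab ℓ, x) := by
        intro c
        by_cases hc : c.1 = .term
        · simp [expRank, hc]
        · simp only [expRank, hc, if_false, reduceCtorEq]
          rw [← ENNReal.ofReal_mul (Real.exp_pos _).le, ← Real.exp_add]
          refine (congrArg (fun s => ENNReal.ofReal (Real.exp s)) ?_).le
          ring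
      refine (lintegral_mono hle).trans ?_
      rw [lintegral_mul_const _ (by fun_prop)]
      gcongr
    · have h0 : expRank η t =ᵐ[stepLaw G D m (.lab ℓ) x] 0 := by
        filter_upwards [ae_stepLaw_term_of_not_termPred hT] with c hc
        simp [expRank, hc]
      rw [lintegral_congr_ae h0]
      simp

theorem admissible_choice {G : CFG L X R} (σ : Scheduler G) (n : ℕ) (ω : ℕ → Config L X) :
    Admissible G (σ.choice n (frestrictLe n ω)) (ω n).1 :=
  fun ℓ T hT h hB => σ.choice_mem n (frestrictLe n ω) ℓ T hT h hB

/-! ### The law of runs and the invariant -/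

section Run

variable [Finite L] [Finite X] [Fintype R] (G : CFG L X R) (D : R → SamplingVar)
  (c₀ : Config L X) (σ : Scheduler G)

instance : IsProbabilityMeasure (runMeasure G D c₀ σ) := by
  unfold runMeasure
  infer_instance

theorem ae_runMeasure_zero : ∀ᵐ ω ∂(runMeasure G D c₀ σ), ω 0 = c₀ := by
  have hrun : runMeasure G D c₀ σ = Kernel.traj (stepKernel G D σ) 0
      ((MeasurableEquiv.piUnique fun _ : Finset.Iic 0 => Config L X).symm c₀) := by
    have hd : (Measure.dirac c₀).map
        (MeasurableEquiv.piUnique fun _ : Finset.Iic 0 => Config L X).symm =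
        Measure.dirac ((MeasurableEquiv.piUnique fun _ : Finset.Iic 0 => Config L X).symm c₀) :=
      Measure.map_dirac' (MeasurableEquiv.measurable _) c₀
    -- Starting from a Dirac mass, the trajectory measure is the trajectory kernel evaluated at the
    -- one-point history; its marginal at time `0` is then the identity kernel.
    rw [← Measure.dirac_bind (Kernel.measurable _)
      ((MeasurableEquiv.piUnique fun _ : Finset.Iic 0 => Config L X).symm c₀), ← hd]
    rfl
  rw [hrun]
  have h := Kernel.traj_map_frestrictLe_apply (X := fun _ => Config L X) (κ := stepKernel G D σ) 0 0
    ((MeasurableEquiv.piUnique fun _ : Finset.Iic 0 => Config L X).symm c₀)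
  rw [Kernel.partialTraj_self, Kernel.id_apply] at h
  have h' : ∀ᵐ y ∂(Measure.dirac
      ((MeasurableEquiv.piUnique fun _ : Finset.Iic 0 => Config L X).symm c₀)),
      y ⟨0, Finset.mem_Iic.2 le_rfl⟩ = c₀ := by
    have hev : Measurable fun y : Finset.Iic 0 → Config L X => y ⟨0, Finset.mem_Iic.2 le_rfl⟩ :=
      measurable_pi_apply _
    exact (ae_dirac_iff (hev (measurableSet_singleton c₀))).2 rfl
  rw [← h] at h'
  exact ae_of_ae_map (by fun_prop) h'

/-- Integrated form of conditioning on the history up to time `n`: the joint law of history and next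
configuration is a composition-product. -/
theorem lintegral_runMeasure_succ {g : Config L X → ENNReal} (hg : Measurable g) (n : ℕ) :
    ∫⁻ ω, g (ω (n + 1)) ∂(runMeasure G D c₀ σ) =
      ∫⁻ ω, ∫⁻ c, g c ∂(stepLaw G D (σ.choice n (frestrictLe n ω)) (ω n).1 (ω n).2)
        ∂(runMeasure G D c₀ σ) := by
  have h := Kernel.map_frestrictLe_trajMeasure_compProd_eq_map_trajMeasure
    (X := fun _ => Config L X) (μ₀ := Measure.dirac c₀) (κ := stepKernel G D σ) (a := n)
  have hg' : Measurable fun q : History L X n × Config L X => g q.2 := hg.comp measurable_snd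
  have h1 := congrArg (fun μ : Measure (History L X n × Config L X) => ∫⁻ q, g q.2 ∂μ) h
  beta_reduce at h1
  rw [lintegral_map hg' (by fun_prop), Measure.lintegral_compProd hg',
    lintegral_map (hg'.lintegral_kernel_prod_right') (by fun_prop)] at h1
  exact h1.symm

/-- The set of reachable configurations is not known to be measurable, so the induction runs over
all measurable supersets `S`. Its step passes from `S` to the set of configurations whose every
admissible step lands in `S` almost surely. -/
theorem ae_runMeasure_of_reachable (n : ℕ) {S : Set (Config L X)} (hS : MeasurableSet S)
    (h : ∀ c, Reachable G D c₀ c → c ∈ S) : ∀ᵐ ω ∂(runMeasure G D c₀ σ), ω n ∈ S := by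
  induction n generalizing S with
  | zero =>
    filter_upwards [ae_runMeasure_zero G D c₀ σ] with ω hω
    exact hω ▸ h _ .refl
  | succ n ih =>
    have hS' : MeasurableSet {c : Config L X |
        ∀ m, Admissible G m c.1 → stepLaw G D m c.1 c.2 Sᶜ = 0} := by
      -- Quantifying over targets `m`, which are countably many, instead of over scheduler choices
      -- keeps this set measurable and independent of the history.
      refine measurableSet_setOfPred.2 (Measurable.forall fun m => ?_)
      refine Measurable.imp ((measurable_of_countable (Admissible G m)).comp measurable_fst) ?_
      have hm : Measurable fun c : Config L X => stepLaw G D m c.1 c.2 Sᶜ :=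
        (Measure.measurable_coe hS.compl).comp
          ((measurable_stepLaw G D).comp (measurable_const.prodMk measurable_id))
      exact measurableSet_setOfPred.1 (hm (measurableSet_singleton 0))
    have hn := ih hS' fun c hc m hm => ae_stepLaw_of_forall_step hm hS
      fun c' hc' => h c' (hc.tail hc')
    have hi : Measurable (Sᶜ.indicator fun _ => (1 : ENNReal)) :=
      measurable_const.indicator hS.compl
    have h0 : ∫⁻ ω, Sᶜ.indicator (fun _ => (1 : ENNReal)) (ω (n + 1))
        ∂(runMeasure G D c₀ σ) = 0 := by
      rw [lintegral_runMeasure_succ G D c₀ σ hi n, lintegral_congr_ae (g := fun _ => 0), lintegral_zero]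
      filter_upwards [hn] with ω hω
      rw [lintegral_indicator_const hS.compl, one_mul]
      exact hω _ (admissible_choice σ n ω)
    rw [lintegral_eq_zero_iff (by fun_prop)] at h0
    filter_upwards [h0] with ω hω
    by_contra hne
    simp [hne] at hω

theorem IsInvariant.ae_runMeasure {G : CFG L X R} {D : R → SamplingVar} {c₀ : Config L X}
    {I : Loc L → PolyPred X} (hI : IsInvariant G D c₀ I) (σ : Scheduler G) (n : ℕ) :
    ∀ᵐ ω ∂(runMeasure G D c₀ σ), (I (ω n).1).Sat (ω n).2 := by
  refine ae_runMeasure_of_reachable G D c₀ σ n (S := {c | (I c.1).Sat c.2}) ?_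
    fun c hc => hI _ _ hc
  have : Measurable fun c : Config L X => (I c.1).Sat c.2 :=
    measurable_from_prod_countable_right fun ℓ => measurableSet_setOfPred.1 (measurableSet_sat (I ℓ))
  exact measurableSet_setOfPred.2 this

end Run

/-! ### Tail bounds for the termination time -/

theorem lintegral_expRank_runMeasure_le [Finite L] [Finite X] [Fintype R] {G : CFG L X R}
    {D : R → SamplingVar} {c₀ : Config L X} {I : Loc L → PolyPred X} {d : ℕ}
    {η : Loc L → (X → ℝ) → ℝ} {ε K a b t : ℝ} (hI : IsInvariant G D c₀ I)
    (hη : IsPRSM G D I d η ε K) (hab : IsDifferenceBounded G D I η a b) (ht : 0 ≤ t)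
    (σ : Scheduler G) (n : ℕ) :
    ∫⁻ ω, expRank η t (ω n) ∂(runMeasure G D c₀ σ) ≤
      ENNReal.ofReal (Real.exp (-(t * ε) + t ^ 2 * (b - a) ^ 2 / 8)) ^ n * expRank η t c₀ := by
  induction n with
  | zero =>
    have h : (fun ω : ℕ → Config L X => expRank η t (ω 0)) =ᵐ[runMeasure G D c₀ σ]
        fun _ => expRank η t c₀ := by
      filter_upwards [ae_runMeasure_zero G D c₀ σ] with ω hω
      rw [hω]
    rw [lintegral_congr_ae h]
    simp
  | succ n ih =>
    have hg := measurable_expRank hη.measurable t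
    rw [lintegral_runMeasure_succ G D c₀ σ hg n, pow_succ', mul_assoc]
    calc _ ≤ ∫⁻ ω, ENNReal.ofReal (Real.exp (-(t * ε) + t ^ 2 * (b - a) ^ 2 / 8)) *
          expRank η t (ω n) ∂(runMeasure G D c₀ σ) := by
          refine lintegral_mono_ae ?_
          filter_upwards [hI.ae_runMeasure σ n] with ω hω
          exact lintegral_expRank_stepLaw_le hη hab ht (admissible_choice σ n ω) hω
      _ = _ := lintegral_const_mul _ (hg.comp (measurable_pi_apply n))
      _ ≤ _ := by gcongr

theorem ne_term_of_lt_termTime {ω : ℕ → Config L X} {n : ℕ} (h : (n : ℕ∞) < termTime ω) :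
    (ω n).1 ≠ .term :=
  fun hn => absurd (iInf₂_le (f := fun (n : ℕ) (_ : (ω n).1 = .term) => (n : ℕ∞)) n hn) h.not_ge

theorem probTermGT_antitone [Finite L] [Finite X] [Fintype R] (G : CFG L X R)
    (D : R → SamplingVar) (c₀ : Config L X) (σ : Scheduler G) :
    Antitone (probTermGT G D c₀ σ) := fun m n h =>
  measureReal_mono fun ω (hω : (n : ℕ∞) < termTime ω) =>
    show (m : ℕ∞) < termTime ω from lt_of_le_of_lt (by exact_mod_cast h) hω

theorem probTermGT_of_term [Finite L] [Finite X] [Fintype R] (G : CFG L X R)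
    (D : R → SamplingVar) (x₀ : X → ℝ) (σ : Scheduler G) (n : ℕ) :
    probTermGT G D (.term, x₀) σ n = 0 := by
  have h : ∀ᵐ ω ∂(runMeasure G D (.term, x₀) σ), ¬ (n : ℕ∞) < termTime ω := by
    filter_upwards [ae_runMeasure_zero G D (.term, x₀) σ] with ω hω hlt
    exact ne_term_of_lt_termTime (n := 0) (lt_of_le_of_lt (by simp) hlt) (by rw [hω])
  have h' : runMeasure G D (.term, x₀) σ {ω | (n : ℕ∞) < termTime ω} = 0 := by
    simpa [ae_iff] using h
  simp [probTermGT, measureReal_def, h']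

/-- The Chernoff bound for the termination time, before optimising the parameter `t`. -/
theorem probTermGT_le_exp [Finite L] [Finite X] [Fintype R] {G : CFG L X R}
    {D : R → SamplingVar} {ℓ₀ : Loc L} {x₀ : X → ℝ} {I : Loc L → PolyPred X} {d : ℕ}
    {η : Loc L → (X → ℝ) → ℝ} {ε K a b t : ℝ} (hI : IsInvariant G D (ℓ₀, x₀) I)
    (hη : IsPRSM G D I d η ε K) (hab : IsDifferenceBounded G D I η a b) (ht : 0 ≤ t)
    (σ : Scheduler G) (n : ℕ) :
    probTermGT G D (ℓ₀, x₀) σ n ≤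
      Real.exp (t * (η ℓ₀ x₀ - ε * n) + n * (t ^ 2 * (b - a) ^ 2 / 8)) := by
  -- A terminal start is separated because there `expRank` is `0` rather than an exponential.
  cases ℓ₀ with
  | term =>
    rw [probTermGT_of_term]
    exact (Real.exp_pos _).le
  | lab ℓ₀ =>
    refine ENNReal.toReal_le_of_le_ofReal (Real.exp_pos _).le ?_
    calc runMeasure G D (.lab ℓ₀, x₀) σ {ω | (n : ℕ∞) < termTime ω}
        ≤ runMeasure G D (.lab ℓ₀, x₀) σ {ω | 1 ≤ expRank η t (ω n)} := by
          refine measure_mono_ae ?_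
          filter_upwards [hI.ae_runMeasure σ n] with ω hω hlt
          have hne := ne_term_of_lt_termTime hlt
          change 1 ≤ expRank η t (ω n)
          rw [expRank, if_neg hne, ENNReal.one_le_ofReal, Real.one_le_exp_iff]
          refine mul_nonneg ht ?_
          cases hl : (ω n).1 with
          | term => exact absurd hl hne
          | lab ℓ => exact hη.nonneg ℓ _ (hl ▸ hω)
      _ ≤ ∫⁻ ω, expRank η t (ω n) ∂(runMeasure G D (.lab ℓ₀, x₀) σ) := by
          -- Markov's inequality at level `1`.
          simpa using meas_ge_le_lintegral_div ((measurable_expRank hη.measurable t).comp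
            (measurable_pi_apply n)).aemeasurable one_ne_zero ENNReal.one_ne_top
            (μ := runMeasure G D (.lab ℓ₀, x₀) σ)
      _ ≤ _ := lintegral_expRank_runMeasure_le hI hη hab ht σ n
      _ = _ := by
          rw [expRank, if_neg (by simp), ← ENNReal.ofReal_pow (Real.exp_pos _).le,
            ← ENNReal.ofReal_mul (by positivity), ← Real.exp_nat_mul, ← Real.exp_add]
          congr 2
          ring

end

end ProbProg

/-! ### Choice of the parameter `t` -/

open ProbProg in
theorem theorem2 {L X R : Type*} [Finite L] [Finite X] [Fintype R]
    (G : ProbProg.CFG L X R) (D : R → ProbProg.SamplingVar)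
    (ℓ₀ : ProbProg.Loc L) (x₀ : X → ℝ)
    (I : ProbProg.Loc L → ProbProg.PolyPred X) (hI : ProbProg.IsInvariant G D (ℓ₀, x₀) I)
    (d : ℕ) (η : ProbProg.Loc L → (X → ℝ) → ℝ) (ε K a b : ℝ)
    (hη : ProbProg.IsPRSM G D I d η ε K)
    (hab : ProbProg.IsDifferenceBounded G D I η a b) :
    (∀ (σ : ProbProg.Scheduler G) (n : ℕ), 1 ≤ n → ε * ((n : ℝ) - 1) > η ℓ₀ x₀ →
      ProbProg.probTermGT G D (ℓ₀, x₀) σ n ≤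
        Real.exp (-(2 * (ε * ((n : ℝ) - 1) - η ℓ₀ x₀) ^ 2 / (((n : ℝ) - 1) * (b - a) ^ 2))) ∧
      -- if the denominator vanishes, the bound reads `exp (-∞) = 0`
      (((n : ℝ) - 1) * (b - a) ^ 2 = 0 → ProbProg.probTermGT G D (ℓ₀, x₀) σ n = 0)) ∧
    ∀ M : ℕ, η ℓ₀ x₀ / ε + 2 ≤ M → ProbProg.IsConcentrationBound G D (ℓ₀, x₀) M := by
  refine ⟨fun σ n hn hgt => ?_, fun M _ => ?_⟩
  · obtain ⟨m, rfl⟩ : ∃ m, n = m + 1 := ⟨n - 1, by omega⟩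
    have hcast : ((m + 1 : ℕ) : ℝ) - 1 = m := by push_cast; ring
    rw [hcast] at hgt ⊢
    -- The Chernoff bound is applied at time `m = n - 1`, and survival past `m + 1` implies survival
    -- past `m`; this produces the `n - 1` of the statement.
    have hbound : ∀ t : ℝ, 0 ≤ t → probTermGT G D (ℓ₀, x₀) σ (m + 1) ≤
        Real.exp (t * (η ℓ₀ x₀ - ε * m) + m * (t ^ 2 * (b - a) ^ 2 / 8)) := fun t ht =>
      (probTermGT_antitone G D _ σ m.le_succ).trans (probTermGT_le_exp hI hη hab ht σ m)
    have hzero : (m : ℝ) * (b - a) ^ 2 = 0 → probTermGT G D (ℓ₀, x₀) σ (m + 1) = 0 := by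
      intro h0
      refine le_antisymm (le_of_forall_pos_le_add fun δ hδ => ?_) MeasureTheory.measureReal_nonneg
      -- With a vanishing denominator the quadratic term disappears, and `η ℓ₀ x₀ - ε * m < 0` lets
      -- `t → ∞` force the probability to `0`. This includes `m = 0`.
      have hlim : Filter.Tendsto (fun t : ℝ => Real.exp (t * (η ℓ₀ x₀ - ε * m)))
          Filter.atTop (nhds 0) :=
        Real.tendsto_exp_atBot.comp
          (Filter.tendsto_id.atTop_mul_const_of_neg (sub_neg.2 hgt))
      obtain ⟨t, ht, htδ⟩ := ((Filter.eventually_ge_atTop 0).and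
        (hlim.eventually (gt_mem_nhds hδ))).exists
      have e : (m : ℝ) * (t ^ 2 * (b - a) ^ 2 / 8) = 0 := by
        linear_combination t ^ 2 / 8 * h0
      have := hbound t ht
      rw [e, add_zero] at this
      linarith
    refine ⟨?_, hzero⟩
    by_cases h0 : (m : ℝ) * (b - a) ^ 2 = 0
    · rw [hzero h0]
      exact (Real.exp_pos _).le
    · have hpos : 0 < (m : ℝ) * (b - a) ^ 2 := lt_of_le_of_ne (by positivity) (Ne.symm h0)
      -- This `t` minimises the quadratic exponent `-tδ + m t² (b-a)²/8`, where `δ = ε * m - η ℓ₀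
      -- x₀`; the minimum is `-2δ²/(m (b-a)²)`.
      refine (hbound (4 * (ε * m - η ℓ₀ x₀) / (m * (b - a) ^ 2))
        (div_nonneg (by linarith) hpos.le)).trans (Real.exp_le_exp.2 (le_of_eq ?_))
      have hm : (m : ℝ) ≠ 0 := left_ne_zero_of_mul h0
      have hw : b - a ≠ 0 := fun h => h0 (by rw [h]; ring)
      field_simp
      ring
  · have hε := hη.eps_pos
    have hw : (0 : ℝ) < (b - a) ^ 2 + 1 := by positivity
    -- A fixed `t` gives a linear exponent in `N`. Since `t * (b-a)² ≤ 4ε`, the quadratic term costs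
    -- at most half of the drift `tεN`, leaving rate `tε/2`. The `+ 1` keeps `t` well defined when
    -- `a = b`.
    set t : ℝ := 4 * ε / ((b - a) ^ 2 + 1) with ht
    have htpos : 0 < t := by positivity
    refine ⟨Real.exp (t * η ℓ₀ x₀), t * ε / 2, (Real.exp_pos _).le, by positivity,
      fun σ N _ => (probTermGT_le_exp hI hη hab htpos.le σ N).trans ?_⟩
    rw [← Real.exp_add]
    refine Real.exp_le_exp.2 ?_
    have h1 : t * (b - a) ^ 2 ≤ 4 * ε := by
      have : t * ((b - a) ^ 2 + 1) = 4 * ε := div_mul_cancel₀ _ hw.ne'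
      linarith
    have h2 : (N : ℝ) * t * (t * (b - a) ^ 2) ≤ N * t * (4 * ε) := by gcongr
    linarith
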